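/- Let $(z_n)$ be a finite or infinite sequence of points of $\{0<|z|<1\}$ with $\sum_n(1-|z_n|)<\infty$ which is interpolating for $H^\infty$, i.e. for every bounded sequence $(a_n)$ of complex numbers there is a bounded analytic function $f$ in the unit disc $\{|z|<1\}$ with $f(z_n)=a_n$ for all $n$. Let $$B(z)=\prod_n\frac{\bar z_n(z_n-z)}{|z_n|(1-\bar z_n z)}$$ be the corresponding (interpolating) Blaschke product. Then for every real $p\ge1$ there is a constant $C=C(p,B)$ such that, for all $0<r<1$, the function $\theta\mapsto|\log|B(re^{i\theta})||^p$ is integrable on $[0,2\pi]$ and $$m_p(r,\log|B|):=\Bigl(\frac1{2\pi}\int_0^{2\pi}\bigl|\log|B(re^{i\theta})|\bigr|^p\,d\theta\Bigr)^{1/p}\le C\Bigl(\log^2\frac1{1-r}+1\Bigr).$$ -/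

import Mathlib

noncomputable section

/-- The family `z` of points lies in the punctured open unit disc and satisfies the Blaschke
condition `∑ (1 - |z i|) < ∞`. As all terms are positive, summability makes the index type
countable: a family is the same as a finite or infinite sequence, with repetitions allowed. -/
structure IsBlaschkeSequence {ι : Type*} (z : ι → ℂ) : Prop where
  norm_lt_one : ∀ i, ‖z i‖ < 1
  ne_zero : ∀ i, z i ≠ 0
  summable : Summable fun i => 1 - ‖z i‖

/-- The Blaschke product
`B(w) = ∏ᵢ conj(zᵢ) (zᵢ - w) / (|zᵢ| (1 - conj(zᵢ) w))` with zero sequence `z`. -/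
def blaschkeProduct {ι : Type*} (z : ι → ℂ) (w : ℂ) : ℂ :=
  ∏' i, (starRingEnd ℂ (z i) * (z i - w)) / ((‖z i‖ : ℂ) * (1 - starRingEnd ℂ (z i) * w))

/-- `z` is an interpolating sequence (for `H^∞`): every bounded family of complex values is
attained along `z` by a bounded analytic function in the open unit disc. -/
def IsInterpolating {ι : Type*} (z : ι → ℂ) : Prop :=
  ∀ a : ι → ℂ, (∃ M : ℝ, ∀ i, ‖a i‖ ≤ M) →
    ∃ f : ℂ → ℂ, DifferentiableOn ℂ f (Metric.ball 0 1) ∧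
      (∃ M : ℝ, ∀ w ∈ Metric.ball (0 : ℂ) 1, ‖f w‖ ≤ M) ∧ ∀ i, f (z i) = a i

/-- The `p`-mean of `log |f|` over the circle `|w| = r`:
`((2π)⁻¹ ∫₀^{2π} |log |f(r e^{iθ})||^p dθ)^{1/p}`. -/
def logMean (p r : ℝ) (f : ℂ → ℂ) : ℝ :=
  (Real.circleAverage (fun w => |Real.log ‖f w‖| ^ p) 0 r) ^ (1 / p)

end

open Metric Set Filter Topology MeasureTheory
open scoped ENNReal

/-! The means are bounded uniformly in `r`; the logarithmic factor is needed only through being at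
least 1. By the open mapping theorem, interpolation of data bounded by 1 costs at most a constant
`M`. Choose signs making a weighted sum `h` of Cauchy kernels at the points small in `L²`, and pair
`h` with a function interpolating these signs. Cauchy's formula and Cauchy–Schwarz (as AM-GM) give
`∑ (1 - |z i|²) ≤ M²`. Interpolation with constant `M` is conformally invariant, so `∑ (1 - ρ i ²) ≤
K` at every `w` of the disc, where `ρ i` is the pseudohyperbolic distance from `w` to `z i`
(`IsInterpolating.exists_sum_one_sub_sq_le`). Hence at each `w` the factors with `ρ i > 1/2`
contribute at most `2 * K` to `-log |B|`, and at most `2 * K` factors remain. On a circle a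
remaining factor is bounded below by a multiple of angular distance over `(1 - |z i|) / |z i|`,
whatever the radius. A power of its logarithm is thus dominated by a rescaled integrable kernel,
whose integral is a multiple of `(1 - |z i|) / |z i|`; these numbers are summable by the Blaschke
condition. -/

/-! ### The interpolation constant -/

/-- The space of bounded analytic functions in the unit disc, as a subspace of the bounded
continuous functions there. -/
def boundedAnalytic : Submodule ℂ (BoundedContinuousFunction (ball (0 : ℂ) 1) ℂ) where
  carrier := {F | ∃ f : ℂ → ℂ, DifferentiableOn ℂ f (ball 0 1) ∧ ∀ w : ball (0 : ℂ) 1, f w = F w}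
  add_mem' := by
    rintro F G ⟨f, hf, hfF⟩ ⟨g, hg, hgG⟩
    exact ⟨f + g, hf.add hg, fun w => by simp [hfF, hgG]⟩
  zero_mem' := ⟨0, differentiableOn_const 0, fun w => by simp⟩
  smul_mem' := by
    rintro c F ⟨f, hf, hfF⟩
    exact ⟨c • f, hf.const_smul c, fun w => by simp [hfF]⟩

/-- Uniform limits of analytic functions are analytic. This supplies the completeness that the open
mapping theorem needs. -/
theorem isClosed_boundedAnalytic :
    IsClosed (boundedAnalytic : Set (BoundedContinuousFunction (ball (0 : ℂ) 1) ℂ)) := by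
  classical
  refine IsSeqClosed.isClosed fun F G hF hG => ?_
  choose f hf hfF using hF
  let g : ℂ → ℂ := fun w => if hw : w ∈ ball (0 : ℂ) 1 then G ⟨w, hw⟩ else 0
  refine ⟨g, ?_, fun w => by simp only [g]; rw [dif_pos w.2]⟩
  refine TendstoLocallyUniformlyOn.differentiableOn (φ := atTop) (F := f) ?_
    (Eventually.of_forall hf) isOpen_ball
  refine TendstoUniformlyOn.tendstoLocallyUniformlyOn ?_
  have hu := BoundedContinuousFunction.tendsto_iff_tendstoUniformly.1 hG
  rw [Metric.tendstoUniformly_iff] at hu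
  rw [Metric.tendstoUniformlyOn_iff]
  intro ε hε
  filter_upwards [hu ε hε] with n hn w hw
  have := hn ⟨w, hw⟩
  simp only [g, dif_pos hw]
  rwa [hfF n ⟨w, hw⟩]

/-- Restriction of bounded analytic functions to a family of points of the disc. -/
noncomputable def boundedAnalyticEval {ι : Type*} (z : ι → ℂ) (hz : ∀ i, ‖z i‖ < 1) :
    boundedAnalytic →L[ℂ] lp (fun _ : ι => ℂ) ⊤ :=
  LinearMap.mkContinuous
    { toFun := fun F => ⟨fun i => F.1 ⟨z i, mem_ball_zero_iff.2 (hz i)⟩,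
        memℓp_infty ⟨‖F‖, by
          rintro _ ⟨i, rfl⟩
          exact F.1.norm_coe_le_norm _⟩⟩
      map_add' := fun F G => by ext i; simp; rfl
      map_smul' := fun c F => by ext i; simp }
    1 (fun F => by
      rw [one_mul]
      exact lp.norm_le_of_forall_le (norm_nonneg F) fun i => F.1.norm_coe_le_norm _)

/-- Interpolating sequences have a finite interpolation constant. -/
theorem IsInterpolating.exists_constant {ι : Type*} {z : ι → ℂ} (hint : IsInterpolating z)
    (hz : ∀ i, ‖z i‖ < 1) :
    ∃ M : ℝ, ∀ a : ι → ℂ, (∀ i, ‖a i‖ ≤ 1) →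
      ∃ f : ℂ → ℂ, DifferentiableOn ℂ f (ball 0 1) ∧ (∀ w ∈ ball (0 : ℂ) 1, ‖f w‖ ≤ M) ∧
        ∀ i, f (z i) = a i := by
  have : IsClosed (boundedAnalytic : Set (BoundedContinuousFunction (ball (0 : ℂ) 1) ℂ)) :=
    isClosed_boundedAnalytic
  have : CompleteSpace boundedAnalytic := IsClosed.completeSpace_coe
  have hsurj : Function.Surjective (boundedAnalyticEval z hz) := by
    intro a
    obtain ⟨f, hf, ⟨M, hM⟩, hfa⟩ := hint (fun i => a i) ⟨‖a‖, fun i => lp.norm_apply_le_norm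
      ENNReal.top_ne_zero a i⟩
    let F : BoundedContinuousFunction (ball (0 : ℂ) 1) ℂ :=
      BoundedContinuousFunction.ofNormedAddCommGroup (fun w => f w)
        (continuousOn_iff_continuous_domRestrict.1 hf.continuousOn) M fun w => hM w w.2
    refine ⟨⟨F, f, hf, fun w => rfl⟩, ?_⟩
    ext i
    exact hfa i
  obtain ⟨M, hM0, hM⟩ := (boundedAnalyticEval z hz).exists_preimage_norm_le hsurj
  refine ⟨M, fun a ha => ?_⟩
  let b : lp (fun _ : ι => ℂ) ⊤ := ⟨a, memℓp_infty ⟨1, by rintro _ ⟨i, rfl⟩; exact ha i⟩⟩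
  have hb : ‖b‖ ≤ 1 := lp.norm_le_of_forall_le zero_le_one ha
  obtain ⟨F, hFb, hFM⟩ := hM b
  obtain ⟨f, hf, hfF⟩ := F.2
  refine ⟨f, hf, fun w hw => ?_, fun i => ?_⟩
  · rw [hfF ⟨w, hw⟩]
    calc ‖F.1 ⟨w, hw⟩‖ ≤ ‖F‖ := F.1.norm_coe_le_norm _
      _ ≤ M * ‖b‖ := hFM
      _ ≤ M := mul_le_of_le_one_right hM0.le hb
  · rw [hfF ⟨z i, mem_ball_zero_iff.2 (hz i)⟩]
    exact congrArg (fun c : lp (fun _ : ι => ℂ) ⊤ => c i) hFb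

/-! ### Choice of signs and duality with Cauchy kernels -/

/-- Signs can be chosen so that the square of the `L²` norm of a sum does not exceed the sum of the
squares. -/
theorem exists_sign_integral_norm_sq_sum_le {ι : Type*} (S : Finset ι) (g : ι → ℝ → ℂ)
    (hg : ∀ i ∈ S, Continuous (g i)) (a b : ℝ) :
    ∃ ε : ι → ℝ, (∀ i, ε i = 1 ∨ ε i = -1) ∧
      ∫ θ in a..b, ‖∑ i ∈ S, (ε i : ℂ) * g i θ‖ ^ 2 ≤ ∑ i ∈ S, ∫ θ in a..b, ‖g i θ‖ ^ 2 := by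
  classical
  induction S using Finset.induction_on with
  | empty => exact ⟨fun _ => 1, fun _ => Or.inl rfl, by simp⟩
  | insert j S hj ih =>
    obtain ⟨ε, hε, h⟩ := ih fun i hi => hg i (Finset.mem_insert_of_mem hi)
    set F : ℝ → ℂ := fun θ => ∑ i ∈ S, (ε i : ℂ) * g i θ with hF
    have hFc : Continuous F := continuous_finsetSum _ fun i hi =>
      continuous_const.mul (hg i (Finset.mem_insert_of_mem hi))
    have hgj : Continuous (g j) := hg j (Finset.mem_insert_self _ _)
    -- By the parallelogram law the two signs average to the sum of the squares, so one of them does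
    -- no worse.
    have key : (∫ θ in a..b, ‖g j θ + F θ‖ ^ 2) + ∫ θ in a..b, ‖-g j θ + F θ‖ ^ 2 =
        2 * (∫ θ in a..b, ‖g j θ‖ ^ 2) + 2 * ∫ θ in a..b, ‖F θ‖ ^ 2 := by
      rw [← intervalIntegral.integral_const_mul, ← intervalIntegral.integral_const_mul,
        ← intervalIntegral.integral_add, ← intervalIntegral.integral_add]
      · refine intervalIntegral.integral_congr fun θ _ => ?_
        have := parallelogram_law_with_norm ℝ (F θ) (g j θ)
        simp only [add_comm (g j θ), neg_add_eq_sub]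
        linarith
      all_goals exact Continuous.intervalIntegrable (by fun_prop) _ _
    have hsum (s : ℝ) (θ : ℝ) : ∑ i ∈ insert j S, ((Function.update ε j s i : ℝ) : ℂ) * g i θ =
        s * g j θ + F θ := by
      rw [Finset.sum_insert hj, Function.update_self]
      congr 1
      refine Finset.sum_congr rfl fun i hi => ?_
      rw [Function.update_of_ne (ne_of_mem_of_not_mem hi hj)]
    have hupd (s : ℝ) (hs : s = 1 ∨ s = -1) (i : ι) :
        Function.update ε j s i = 1 ∨ Function.update ε j s i = -1 := by
      rcases eq_or_ne i j with rfl | hij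
      · simpa using hs
      · simpa [hij] using hε i
    rcases le_total (∫ θ in a..b, ‖g j θ + F θ‖ ^ 2) (∫ θ in a..b, ‖-g j θ + F θ‖ ^ 2) with hle | hle
    · refine ⟨Function.update ε j 1, hupd 1 (Or.inl rfl), ?_⟩
      simp only [hsum, Finset.sum_insert hj, Complex.ofReal_one, one_mul]
      linarith
    · refine ⟨Function.update ε j (-1), hupd (-1) (Or.inr rfl), ?_⟩
      simp only [hsum, Finset.sum_insert hj, Complex.ofReal_neg, Complex.ofReal_one, neg_one_mul]
      linarith

/-- The squared `L²` norm of the Cauchy kernel on the circle of radius `R`. -/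
theorem circleAverage_norm_sq_cauchyKernel {R : ℝ} {z : ℂ} (hz : ‖z‖ < R) :
    Real.circleAverage (fun ζ => ‖ζ / (ζ - z)‖ ^ 2) 0 R = R ^ 2 / (R ^ 2 - ‖z‖ ^ 2) := by
  have hR : 0 < R := (norm_nonneg z).trans_lt hz
  have hne (ζ : ℂ) (hζ : ‖ζ‖ ≤ R) : (R : ℂ) ^ 2 - starRingEnd ℂ z * ζ ≠ 0 := by
    intro h
    have h1 : ‖(R : ℂ) ^ 2‖ = ‖starRingEnd ℂ z * ζ‖ := by rw [sub_eq_zero.1 h]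
    simp only [norm_pow, Complex.norm_real, Real.norm_eq_abs, sq_abs, norm_mul,
      RCLike.norm_conj] at h1
    nlinarith [norm_nonneg z]
  -- On `|ζ| = R` this analytic function is the conjugate of the kernel, so Cauchy's formula at `z`
  -- computes the squared norm.
  have hd : DiffContOnCl ℂ (fun ζ : ℂ => (R : ℂ) ^ 2 / ((R : ℂ) ^ 2 - starRingEnd ℂ z * ζ))
      (ball 0 |R|) := by
    refine DifferentiableOn.diffContOnCl fun ζ hζ => ?_
    have hζ' : ‖ζ‖ ≤ R := by
      simpa [abs_of_pos hR] using closure_ball_subset_closedBall hζ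
    exact DifferentiableAt.differentiableWithinAt (by fun_prop (disch := exact hne ζ hζ'))
  have h := hd.circleAverage_smul_div (w := z) (by simpa [abs_of_pos hR] using hz)
  have h2 : Real.circleAverage (fun ζ => ((‖ζ / (ζ - z)‖ ^ 2 : ℝ) : ℂ)) 0 R =
      ((R ^ 2 / (R ^ 2 - ‖z‖ ^ 2) : ℝ) : ℂ) := by
    have hval : (R : ℂ) ^ 2 / ((R : ℂ) ^ 2 - starRingEnd ℂ z * z) =
        ((R ^ 2 / (R ^ 2 - ‖z‖ ^ 2) : ℝ) : ℂ) := by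
      rw [Complex.conj_mul']; push_cast; rfl
    rw [← hval, ← h]
    refine Real.circleAverage_congr_sphere fun ζ hζ => ?_
    have hζ' : ‖ζ‖ = R := by simpa [abs_of_pos hR] using hζ
    have hζz : ζ - z ≠ 0 := by
      intro h0
      rw [sub_eq_zero.1 h0] at hζ'
      exact hz.ne hζ'
    have hζ0 : ζ ≠ 0 := by rintro rfl; simp at hζ'; exact hR.ne hζ'
    have hR2 : (R : ℂ) ^ 2 = starRingEnd ℂ ζ * ζ := by rw [Complex.conj_mul', hζ']
    have hcz : starRingEnd ℂ ζ - starRingEnd ℂ z ≠ 0 := by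
      rw [← map_sub]; exact (map_ne_zero _).2 hζz
    simp only [Complex.ofReal_pow, ← Complex.conj_mul', map_div₀, map_sub, sub_zero, smul_eq_mul,
      hR2, ← sub_mul]
    field_simp
  have h3 := Complex.ofRealCLM.circleAverage_comp_comm (f := fun ζ => ‖ζ / (ζ - z)‖ ^ 2) (c := 0)
    (R := R) ?_
  · apply Complex.ofReal_injective
    rw [← h2]
    exact h3.symm
  · refine ContinuousOn.circleIntegrable hR.le ?_
    refine ((continuousOn_id.div (continuousOn_id.sub continuousOn_const) fun ζ hζ h0 => ?_).norm).pow 2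
    have hζ' : ‖ζ‖ = R := by simpa using hζ
    rw [sub_eq_zero.1 (show ζ - z = 0 from h0)] at hζ'
    exact hz.ne hζ'

/-- If every choice of signs on the points `z i`, `i ∈ S`, is interpolated by an analytic function
bounded by `M`, then `∑ (1 - |z i|²) ≤ M²`. -/
theorem sum_one_sub_norm_sq_le_of_interpolation {ι : Type*} {z : ι → ℂ} {M : ℝ} (S : Finset ι)
    (hz : ∀ i ∈ S, ‖z i‖ < 1)
    (hM : ∀ ε : ι → ℝ, (∀ i, ε i = 1 ∨ ε i = -1) →
      ∃ f : ℂ → ℂ, DifferentiableOn ℂ f (ball 0 1) ∧ (∀ w ∈ ball (0 : ℂ) 1, ‖f w‖ ≤ M) ∧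
        ∀ i ∈ S, f (z i) = ε i) :
    ∑ i ∈ S, (1 - ‖z i‖ ^ 2) ≤ M ^ 2 := by
  -- Boundary values on the unit circle are avoided by working on `|ζ| = R < 1` and letting `R` tend
  -- to 1.
  have main (R : ℝ) (hR0 : 0 < R) (hR : R < 1) (hzR : ∀ i ∈ S, ‖z i‖ < R) :
      ∑ i ∈ S, (1 - ‖z i‖ ^ 2 / R ^ 2) ≤ M ^ 2 := by
    -- The kernel has mean square `1 / d i`, so with weight `d i` it has mean square `d i`, the same
    -- quantity that the pairing with `f` produces.
    set d : ι → ℝ := fun i => 1 - ‖z i‖ ^ 2 / R ^ 2 with hd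
    set k : ι → ℂ → ℂ := fun i ζ => ζ / (ζ - z i) with hk
    have hne (θ : ℝ) (i : ι) (hi : i ∈ S) : circleMap 0 R θ - z i ≠ 0 := by
      intro h0
      have := hzR i hi
      rw [← sub_eq_zero.1 h0, norm_circleMap_zero, abs_of_pos hR0] at this
      exact lt_irrefl _ this
    have hkc (i : ι) (hi : i ∈ S) : Continuous fun θ => k i (circleMap 0 R θ) :=
      (continuous_circleMap 0 R).div ((continuous_circleMap 0 R).sub continuous_const)
        fun θ => hne θ i hi
    obtain ⟨ε, hε, hQ⟩ := exists_sign_integral_norm_sq_sum_le S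
      (fun i θ => (d i : ℂ) * k i (circleMap 0 R θ))
      (fun i hi => continuous_const.mul (hkc i hi)) 0 (2 * Real.pi)
    obtain ⟨f, hf, hfM, hfz⟩ := hM ε hε
    have hcirc (θ : ℝ) : circleMap 0 R θ ∈ ball (0 : ℂ) 1 := by
      simpa [abs_of_pos hR0] using hR
    have hfc : Continuous fun θ => f (circleMap 0 R θ) :=
      hf.continuousOn.comp_continuous (continuous_circleMap 0 R) hcirc
    have hfd : DiffContOnCl ℂ f (ball 0 |R|) := by
      refine (hf.mono ?_).diffContOnCl
      rw [abs_of_pos hR0]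
      exact closure_ball_subset_closedBall.trans (closedBall_subset_ball hR)
    have hrep (i : ι) (hi : i ∈ S) :
        ∫ θ in 0..2 * Real.pi, k i (circleMap 0 R θ) * f (circleMap 0 R θ) =
          2 * Real.pi * (ε i : ℂ) := by
      have h := hfd.circleAverage_smul_div (w := z i)
        (by simpa [abs_of_pos hR0] using hzR i hi)
      rw [hfz i hi, Real.circleAverage_def] at h
      simp only [sub_zero, smul_eq_mul] at h
      rw [← h, Complex.real_smul]
      push_cast
      rw [← mul_assoc, mul_inv_cancel₀ (by exact_mod_cast Real.two_pi_pos.ne'), one_mul]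
    have hnorm (i : ι) (hi : i ∈ S) :
        ∫ θ in 0..2 * Real.pi, ‖(d i : ℂ) * k i (circleMap 0 R θ)‖ ^ 2 = 2 * Real.pi * d i := by
      have h := circleAverage_norm_sq_cauchyKernel (hzR i hi)
      rw [Real.circleAverage_def, smul_eq_mul, inv_mul_eq_iff_eq_mul₀ Real.two_pi_pos.ne'] at h
      simp only [norm_mul, mul_pow, intervalIntegral.integral_const_mul]
      rw [h]
      have : R ^ 2 - ‖z i‖ ^ 2 ≠ 0 := by
        have := hzR i hi
        nlinarith [norm_nonneg (z i)]
      simp only [hd, Complex.norm_real, Real.norm_eq_abs, sq_abs]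
      field_simp
    simp only [Finset.sum_congr rfl hnorm, ← Finset.mul_sum] at hQ
    set h : ℝ → ℂ := fun θ => ∑ i ∈ S, (ε i : ℂ) * ((d i : ℂ) * k i (circleMap 0 R θ)) with hh
    have hhc : Continuous h := continuous_finsetSum _ fun i hi =>
      continuous_const.mul (continuous_const.mul (hkc i hi))
    have hpair : ∫ θ in 0..2 * Real.pi, h θ * f (circleMap 0 R θ) =
        ((2 * Real.pi * ∑ i ∈ S, d i : ℝ) : ℂ) := by
      simp only [hh, Finset.sum_mul]
      rw [intervalIntegral.integral_finsetSum]
      · push_cast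
        rw [Finset.mul_sum]
        refine Finset.sum_congr rfl fun i hi => ?_
        have hsq : (ε i : ℂ) * ε i = 1 := by rcases hε i with h | h <;> simp [h]
        simp only [mul_assoc]
        rw [intervalIntegral.integral_const_mul, intervalIntegral.integral_const_mul, hrep i hi]
        linear_combination (2 * Real.pi * d i : ℂ) * hsq
      · intro i hi
        exact ((continuous_const.mul (continuous_const.mul (hkc i hi))).mul hfc).intervalIntegrable
          _ _
    have hdnn : 0 ≤ ∑ i ∈ S, d i := Finset.sum_nonneg fun i hi => by
      have := hzR i hi
      rw [hd]; dsimp only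
      rw [sub_nonneg, div_le_one (by positivity)]
      gcongr
    have h1 : 2 * Real.pi * ∑ i ∈ S, d i ≤
        ∫ θ in 0..2 * Real.pi, (M ^ 2 / 2 + 1 / 2 * ‖h θ‖ ^ 2) := by
      have e : 2 * Real.pi * ∑ i ∈ S, d i =
          ‖∫ θ in 0..2 * Real.pi, h θ * f (circleMap 0 R θ)‖ := by
        rw [hpair, Complex.norm_real, Real.norm_of_nonneg (by positivity)]
      rw [e]
      refine intervalIntegral.norm_integral_le_of_norm_le Real.two_pi_pos.le
        (Eventually.of_forall fun θ _ => ?_) ?_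
      · rw [norm_mul]
        have := hfM _ (hcirc θ)
        nlinarith [sq_nonneg (‖h θ‖ - ‖f (circleMap 0 R θ)‖), norm_nonneg (f (circleMap 0 R θ)),
          norm_nonneg (h θ)]
      · exact Continuous.intervalIntegrable (by fun_prop) _ _
    rw [intervalIntegral.integral_add (Continuous.intervalIntegrable (by fun_prop) _ _)
      (Continuous.intervalIntegrable (by fun_prop) _ _), intervalIntegral.integral_const_mul,
      intervalIntegral.integral_const, smul_eq_mul, sub_zero] at h1
    nlinarith [Real.pi_pos]
  have hlim : Tendsto (fun R : ℝ => ∑ i ∈ S, (1 - ‖z i‖ ^ 2 / R ^ 2)) (𝓝[<] 1)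
      (𝓝 (∑ i ∈ S, (1 - ‖z i‖ ^ 2 / 1 ^ 2))) := by
    refine tendsto_nhdsWithin_of_tendsto_nhds (tendsto_finsetSum _ fun i _ => ?_)
    exact tendsto_const_nhds.sub (tendsto_const_nhds.div (tendsto_id.pow 2) (by norm_num))
  simp only [one_pow, div_one] at hlim
  refine le_of_tendsto hlim ?_
  have hev : ∀ᶠ R : ℝ in 𝓝[<] 1, ∀ i ∈ S, ‖z i‖ < R :=
    (S.eventually_all).2 fun i hi => eventually_nhdsWithin_of_eventually_nhds
      (lt_mem_nhds (hz i hi))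
  filter_upwards [hev, self_mem_nhdsWithin, eventually_nhdsWithin_of_eventually_nhds
    (lt_mem_nhds (zero_lt_one' ℝ))] with R h1 h2 h3
  exact main R h3 h2 h1

/-! ### Conformal invariance -/

/-- The involutive automorphism of the unit disc exchanging `0` and `w`. -/
noncomputable def discInvolution (w u : ℂ) : ℂ := (w - u) / (1 - starRingEnd ℂ w * u)

theorem one_sub_conj_mul_ne_zero {w u : ℂ} (hw : ‖w‖ < 1) (hu : ‖u‖ ≤ 1) :
    1 - starRingEnd ℂ w * u ≠ 0 := by
  intro h
  have h1 : ‖starRingEnd ℂ w * u‖ = 1 := by rw [← sub_eq_zero.1 h, norm_one]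
  rw [norm_mul, RCLike.norm_conj] at h1
  nlinarith [norm_nonneg w, norm_nonneg u]

theorem norm_one_sub_conj_mul_sq_sub (w u : ℂ) :
    ‖1 - starRingEnd ℂ w * u‖ ^ 2 - ‖w - u‖ ^ 2 = (1 - ‖w‖ ^ 2) * (1 - ‖u‖ ^ 2) := by
  simp only [← Complex.normSq_eq_norm_sq, Complex.normSq_apply, Complex.sub_re, Complex.sub_im,
    Complex.mul_re, Complex.mul_im, Complex.conj_re, Complex.conj_im, Complex.one_re,
    Complex.one_im]
  ring

theorem norm_discInvolution_lt_one {w u : ℂ} (hw : ‖w‖ < 1) (hu : ‖u‖ < 1) :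
    ‖discInvolution w u‖ < 1 := by
  have h0 := norm_pos_iff.2 (one_sub_conj_mul_ne_zero hw hu.le)
  rw [discInvolution, norm_div, div_lt_one h0]
  refine lt_of_pow_lt_pow_left₀ 2 h0.le ?_
  have h1 : 0 < 1 - ‖w‖ ^ 2 := by nlinarith [norm_nonneg w]
  have h2 : 0 < 1 - ‖u‖ ^ 2 := by nlinarith [norm_nonneg u]
  linarith [norm_one_sub_conj_mul_sq_sub w u, mul_pos h1 h2]

theorem discInvolution_involutive {w u : ℂ} (hw : ‖w‖ < 1) (hu : ‖u‖ < 1) :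
    discInvolution w (discInvolution w u) = u := by
  have h0 := one_sub_conj_mul_ne_zero hw hu.le
  have h1 := one_sub_conj_mul_ne_zero hw (norm_discInvolution_lt_one hw hu).le
  have e : discInvolution w u * (1 - starRingEnd ℂ w * u) = w - u := div_mul_cancel₀ _ h0
  rw [discInvolution, div_eq_iff h1]
  linear_combination -e

theorem norm_discInvolution_comm (w u : ℂ) : ‖discInvolution w u‖ = ‖discInvolution u w‖ := by
  rw [discInvolution, discInvolution, norm_div, norm_div, norm_sub_rev w u]
  congr 1
  rw [← RCLike.norm_conj (1 - starRingEnd ℂ w * u)]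
  simp [mul_comm]

theorem differentiableOn_discInvolution {w : ℂ} (hw : ‖w‖ < 1) :
    DifferentiableOn ℂ (discInvolution w) (ball 0 1) := by
  intro u hu
  have := one_sub_conj_mul_ne_zero hw (mem_ball_zero_iff.1 hu).le
  unfold discInvolution
  exact DifferentiableAt.differentiableWithinAt (by fun_prop (disch := exact this))

/-- Interpolating sequences satisfy the Carleson condition, in its conformally invariant form. -/
theorem IsInterpolating.exists_sum_one_sub_sq_le {ι : Type*} {z : ι → ℂ}
    (hint : IsInterpolating z) (hz : ∀ i, ‖z i‖ < 1) :
    ∃ K : ℝ, ∀ (S : Finset ι) (w : ℂ), ‖w‖ < 1 →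
      ∑ i ∈ S, (1 - ‖discInvolution (z i) w‖ ^ 2) ≤ K := by
  obtain ⟨M, hM⟩ := hint.exists_constant hz
  refine ⟨M ^ 2, fun S w hw => ?_⟩
  simp only [norm_discInvolution_comm _ w]
  refine sum_one_sub_norm_sq_le_of_interpolation S
    (fun i _ => norm_discInvolution_lt_one hw (hz i)) fun ε hε => ?_
  have hmaps : MapsTo (discInvolution w) (ball 0 1) (ball 0 1) := fun u hu => by
    rw [mem_ball_zero_iff] at hu ⊢
    exact norm_discInvolution_lt_one hw hu
  obtain ⟨f, hf, hfM, hfz⟩ := hM (fun i => (ε i : ℂ)) fun i => by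
    rcases hε i with h | h <;> simp [h]
  refine ⟨f ∘ discInvolution w, hf.comp (differentiableOn_discInvolution hw) hmaps,
    fun u hu => hfM _ (hmaps hu), fun i _ => ?_⟩
  rw [Function.comp_apply, discInvolution_involutive hw (hz i), hfz]

/-! ### Logarithm of a product: near and far factors -/

theorem neg_log_le_two_mul_one_sub_sq {ρ : ℝ} (h : 1 / 2 < ρ) (h1 : ρ ≤ 1) :
    -Real.log ρ ≤ 2 * (1 - ρ ^ 2) := by
  have h0 : 0 < ρ := by linarith
  have h2 := Real.one_sub_inv_le_log_of_pos h0
  have h3 : ρ⁻¹ - 1 ≤ 2 * (1 - ρ ^ 2) := by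
    have : ρ⁻¹ ≤ 1 + 2 * (1 - ρ ^ 2) := by
      rw [inv_le_iff_one_le_mul₀ h0]
      nlinarith [mul_nonneg (sub_nonneg.2 h1) h0.le, mul_nonneg (mul_nonneg (sub_nonneg.2 h1) h0.le) h0.le]
    linarith
  linarith

/-- The `p`-th power of the logarithm of a product of numbers `ρ i ∈ [0, 1]`, in terms of
`∑ (1 - ρ i ^ 2)` and of the factors that are at most `1 / 2`. -/
theorem abs_log_prod_rpow_le {ι : Type*} (S : Finset ι) {ρ : ι → ℝ} {K p : ℝ} (hp : 1 ≤ p)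
    (h0 : ∀ i ∈ S, 0 ≤ ρ i) (h1 : ∀ i ∈ S, ρ i ≤ 1) (hK : ∑ i ∈ S, (1 - ρ i ^ 2) ≤ K) :
    |Real.log (∏ i ∈ S, ρ i)| ^ p ≤ (2 * K + 1) ^ (p - 1) *
      ((2 * K) ^ p + ∑ i ∈ S with ρ i ≤ 1 / 2, (-Real.log (ρ i)) ^ p) := by
  have hterm (i : ι) (hi : i ∈ S) : 0 ≤ 1 - ρ i ^ 2 := by
    nlinarith [h0 i hi, h1 i hi]
  have hlog (i : ι) (hi : i ∈ S) : 0 ≤ -Real.log (ρ i) :=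
    neg_nonneg.2 (Real.log_nonpos (h0 i hi) (h1 i hi))
  have hK0 : 0 ≤ K := (Finset.sum_nonneg hterm).trans hK
  have hF (i : ι) (hi : i ∈ S.filter (ρ · ≤ 1 / 2)) : i ∈ S := (Finset.mem_filter.1 hi).1
  have hsum0 : 0 ≤ ∑ i ∈ S with ρ i ≤ 1 / 2, (-Real.log (ρ i)) ^ p :=
    Finset.sum_nonneg fun i hi => Real.rpow_nonneg (hlog i (hF i hi)) _
  by_cases hz : ∃ i ∈ S, ρ i = 0
  · rw [Finset.prod_eq_zero_iff.2 hz, Real.log_zero, abs_zero, Real.zero_rpow (by linarith)]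
    positivity
  push Not at hz
  have hcard : ((S.filter (ρ · ≤ 1 / 2)).card : ℝ) ≤ 2 * K := by
    have : ∑ i ∈ S with ρ i ≤ 1 / 2, (1 / 2 : ℝ) ≤ ∑ i ∈ S with ρ i ≤ 1 / 2, (1 - ρ i ^ 2) :=
      Finset.sum_le_sum fun i hi => by
        nlinarith [h0 i (hF i hi), (Finset.mem_filter.1 hi).2]
    rw [Finset.sum_const, nsmul_eq_mul] at this
    have h2 : ∑ i ∈ S with ρ i ≤ 1 / 2, (1 - ρ i ^ 2) ≤ ∑ i ∈ S, (1 - ρ i ^ 2) :=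
      Finset.sum_le_sum_of_subset_of_nonneg (Finset.filter_subset _ _) fun i hi _ => hterm i hi
    linarith
  have hle : |Real.log (∏ i ∈ S, ρ i)| ≤
      2 * K + ∑ i ∈ S with ρ i ≤ 1 / 2, -Real.log (ρ i) := by
    rw [Real.log_prod hz, ← abs_neg, ← Finset.sum_neg_distrib,
      abs_of_nonneg (Finset.sum_nonneg hlog), ← Finset.sum_filter_add_sum_filter_not S (ρ · ≤ 1 / 2),
      add_comm]
    gcongr
    calc ∑ i ∈ S with ¬ ρ i ≤ 1 / 2, -Real.log (ρ i)
        ≤ ∑ i ∈ S with ¬ ρ i ≤ 1 / 2, 2 * (1 - ρ i ^ 2) := Finset.sum_le_sum fun i hi =>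
          neg_log_le_two_mul_one_sub_sq (not_le.1 (Finset.mem_filter.1 hi).2)
            (h1 i (Finset.mem_filter.1 hi).1)
      _ ≤ ∑ i ∈ S, 2 * (1 - ρ i ^ 2) := Finset.sum_le_sum_of_subset_of_nonneg
          (Finset.filter_subset _ _) fun i hi _ => mul_nonneg zero_le_two (hterm i hi)
      _ ≤ 2 * K := by rw [← Finset.mul_sum]; gcongr
  refine (Real.rpow_le_rpow (abs_nonneg _) hle (by linarith)).trans ?_
  -- The extra index `none` carries the far contribution `2 * K`, whence at most `2 * K + 1` terms
  -- in the power mean inequality.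
  have hpm := Real.rpow_sum_le_const_mul_sum_rpow_of_nonneg
    (s := Finset.insertNone (S.filter (ρ · ≤ 1 / 2)))
    (f := fun o => o.elim (2 * K) fun i => -Real.log (ρ i)) hp (by
      rintro (_ | i) hi
      · simpa using hK0
      · exact hlog i (hF i (by simpa using hi)))
  simp only [Finset.sum_insertNone, Finset.card_insertNone, Option.elim_none,
    Option.elim_some] at hpm
  refine hpm.trans ?_
  gcongr
  push_cast
  linarith

/-! ### An integrable majorant for powers of the logarithm -/

/-- The function `|s| ^ (-1/2)` on `[-1, 1]`, extended by zero. -/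
noncomputable def invSqrtKernel : ℝ → ℝ≥0∞ :=
  (Icc (-1) 1).indicator fun s => ENNReal.ofReal |s| ^ (-(1 / 2) : ℝ)

@[fun_prop]
theorem measurable_invSqrtKernel : Measurable invSqrtKernel :=
  Measurable.indicator (by fun_prop) measurableSet_Icc

theorem lintegral_invSqrtKernel_lt_top : ∫⁻ s, invSqrtKernel s < ∞ := by
  rw [invSqrtKernel, lintegral_indicator measurableSet_Icc]
  have hi : IntervalIntegrable (fun s : ℝ => |s| ^ (-(1 / 2) : ℝ)) volume (-1) 1 := by
    refine intervalIntegrable_of_even (fun s => by rw [abs_neg]) fun x hx => ?_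
    refine (intervalIntegral.intervalIntegrable_rpow' (r := -(1 / 2)) (by norm_num)).congr ?_
    intro s hs
    rw [uIoc_of_le hx.le] at hs
    simp only [abs_of_pos hs.1]
  rw [intervalIntegrable_iff_integrableOn_Icc_of_le (by norm_num)] at hi
  have h := hi.lintegral_lt_top
  refine lt_of_le_of_lt (le_of_eq ?_) h
  refine lintegral_congr_ae (ae_restrict_of_ae ?_)
  filter_upwards [compl_mem_ae_iff.2 (measure_singleton (0 : ℝ))] with s hs
  exact ENNReal.ofReal_rpow_of_pos (abs_pos.2 hs)

theorem lintegral_invSqrtKernel_sub_div {A : ℝ} (hA : 0 < A) (x : ℝ) :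
    ∫⁻ θ, invSqrtKernel ((θ - x) / A) = ENNReal.ofReal A * ∫⁻ s, invSqrtKernel s := by
  rw [lintegral_sub_right_eq_self (fun θ => invSqrtKernel (θ / A)) x]
  simp only [div_eq_mul_inv]
  rw [← lintegral_map (f := invSqrtKernel) (g := fun θ => θ * A⁻¹) (by fun_prop) (by fun_prop),
    Real.map_volume_mul_right (inv_ne_zero hA.ne'), lintegral_smul_measure, inv_inv,
    abs_of_pos hA, smul_eq_mul]

theorem ofReal_neg_log_rpow_le {p x ρ : ℝ} (hp : 0 < p) (hx : |x| ≤ ρ) (hρ : ρ ≤ 1) :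
    ENNReal.ofReal ((-Real.log ρ) ^ p) ≤ ENNReal.ofReal ((2 * p) ^ p) * invSqrtKernel x := by
  rw [invSqrtKernel, indicator_of_mem (show x ∈ Icc (-1) 1 from abs_le.1 (hx.trans hρ))]
  have hc : 0 < (2 * p) ^ p := by positivity
  -- At `x = 0` the kernel is infinite, so nothing is to be shown.
  rcases eq_or_ne x 0 with rfl | hx0
  · rw [abs_zero, ENNReal.ofReal_zero, ENNReal.zero_rpow_of_neg (by norm_num), ENNReal.mul_top
      (by simpa using hc)]
    exact le_top
  have hx1 : 0 < |x| := abs_pos.2 hx0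
  rw [ENNReal.ofReal_rpow_of_pos hx1, ← ENNReal.ofReal_mul hc.le]
  refine ENNReal.ofReal_le_ofReal ?_
  have hρ0 : 0 < ρ := hx1.trans_le hx
  calc (-Real.log ρ) ^ p ≤ (Real.log |x|⁻¹) ^ p := by
        refine Real.rpow_le_rpow (neg_nonneg.2 (Real.log_nonpos hρ0.le hρ)) ?_ hp.le
        rw [Real.log_inv]
        exact neg_le_neg (Real.log_le_log hx1 hx)
    -- `log t ≤ t ^ ε / ε` with `ε = 1 / (2 * p)`, chosen so that the `p`-th power leaves exponent
    -- `1/2`.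
    _ ≤ (|x|⁻¹ ^ (1 / (2 * p)) / (1 / (2 * p))) ^ p := by
        refine Real.rpow_le_rpow (Real.log_nonneg ?_) (Real.log_le_rpow_div (by positivity)
          (by positivity)) hp.le
        exact (one_le_inv₀ hx1).2 (hx.trans hρ)
    _ = (2 * p) ^ p * |x| ^ (-(1 / 2) : ℝ) := by
        rw [div_div_eq_mul_div, div_one, Real.mul_rpow (by positivity) (by positivity), mul_comm,
          ← Real.rpow_mul (by positivity), Real.inv_rpow (by positivity), Real.rpow_neg
          (by positivity)]
        congr 3
        field_simp

/-! ### A Blaschke factor on a circle -/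

/-- The point of modulus `‖a‖` and argument `θ` is at distance `2 ‖a‖ |sin|` from `a`, and no
farther from the circle point than `a` is. The triangle inequality then gives a bound free of `r`.
-/
theorem norm_mul_abs_sin_le (a : ℂ) {r : ℝ} (hr : 0 ≤ r) (θ : ℝ) :
    ‖a‖ * |Real.sin ((θ - a.arg) / 2)| ≤ ‖a - circleMap 0 r θ‖ := by
  set w := circleMap 0 r θ with hw
  have hwn : ‖w‖ = r := by simp [hw, abs_of_nonneg hr]
  have hwe : w = r * Complex.exp (θ * Complex.I) := by simp [hw, circleMap]
  have ha : (‖a‖ : ℂ) * Complex.exp (a.arg * Complex.I) = a := Complex.norm_mul_exp_arg_mul_I a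
  have h1 : ‖(‖a‖ : ℂ) * Complex.exp (θ * Complex.I) - a‖ =
      ‖a‖ * (2 * |Real.sin ((θ - a.arg) / 2)|) := by
    have h2 := Complex.norm_exp_I_mul_ofReal_sub_one (θ - a.arg)
    rw [norm_mul, Real.norm_eq_abs, Real.norm_eq_abs, abs_two] at h2
    rw [← h2]
    nth_rewrite 2 [← ha]
    rw [← mul_sub, norm_mul, Complex.norm_real, norm_norm]
    congr 1
    have : Complex.exp (θ * Complex.I) - Complex.exp (a.arg * Complex.I) =
        Complex.exp (a.arg * Complex.I) *
          (Complex.exp (Complex.I * ((θ - a.arg : ℝ) : ℂ)) - 1) := by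
      rw [mul_sub, ← Complex.exp_add, mul_one]
      congr 2
      push_cast
      ring
    rw [this, norm_mul, Complex.norm_exp_ofReal_mul_I, one_mul]
  have h3 : ‖(‖a‖ : ℂ) * Complex.exp (θ * Complex.I) - w‖ ≤ ‖a - w‖ := by
    rw [hwe, ← sub_mul, norm_mul, Complex.norm_exp_ofReal_mul_I, mul_one, ← hwe,
      ← Complex.ofReal_sub, Complex.norm_real, Real.norm_eq_abs, ← hwn]
    exact abs_norm_sub_norm_le a w
  have h4 := norm_sub_le_norm_sub_add_norm_sub ((‖a‖ : ℂ) * Complex.exp (θ * Complex.I)) w a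
  rw [norm_sub_rev w a] at h4
  linarith

/-- The denominator is at most `2 (1 - ‖a‖) + ‖a - w‖`. Nearness makes the last term at most half
the denominator; absorbing it gives the 4. -/
theorem norm_sub_div_le_norm_discInvolution {a w : ℂ} (ha : ‖a‖ < 1) (hw : ‖w‖ < 1)
    (h : ‖discInvolution a w‖ ≤ 1 / 2) :
    ‖a - w‖ / (4 * (1 - ‖a‖)) ≤ ‖discInvolution a w‖ := by
  have h0 := norm_pos_iff.2 (one_sub_conj_mul_ne_zero ha hw.le)
  rw [discInvolution, norm_div] at h ⊢
  have h1 : ‖a - w‖ ≤ 1 / 2 * ‖1 - starRingEnd ℂ a * w‖ := (div_le_iff₀ h0).1 h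
  have h2 : ‖1 - starRingEnd ℂ a * w‖ ≤ (1 - ‖a‖ ^ 2) + ‖a‖ * ‖a - w‖ := by
    have : 1 - starRingEnd ℂ a * w = ((1 - ‖a‖ ^ 2 : ℝ) : ℂ) + starRingEnd ℂ a * (a - w) := by
      push_cast
      rw [← Complex.conj_mul']
      ring
    rw [this]
    refine (norm_add_le _ _).trans_eq ?_
    rw [Complex.norm_real, norm_mul, RCLike.norm_conj, Real.norm_of_nonneg]
    nlinarith [norm_nonneg a]
  refine div_le_div_of_nonneg_left (norm_nonneg _) h0 ?_
  nlinarith [norm_nonneg a, norm_nonneg (a - w)]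

/-- On a circle, the logarithmic singularity of a Blaschke factor is dominated by a kernel at
scale `(1 - ‖a‖) / ‖a‖`. -/
theorem ofReal_neg_log_norm_discInvolution_rpow_le {a : ℂ} {p r θ : ℝ} (hp : 0 < p)
    (ha0 : a ≠ 0) (ha : ‖a‖ < 1) (hr0 : 0 ≤ r) (hr : r < 1) (hθ : θ ∈ Ioc 0 (2 * Real.pi))
    (h : ‖discInvolution a (circleMap 0 r θ)‖ ≤ 1 / 2) :
    ENNReal.ofReal ((-Real.log ‖discInvolution a (circleMap 0 r θ)‖) ^ p) ≤
      ENNReal.ofReal ((2 * p) ^ p) *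
        (invSqrtKernel ((θ - a.arg) / (4 * Real.pi * ((1 - ‖a‖) / ‖a‖))) +
          invSqrtKernel ((θ - (a.arg + 2 * Real.pi)) / (4 * Real.pi * ((1 - ‖a‖) / ‖a‖)))) := by
  have hpi := Real.pi_pos
  have han : 0 < ‖a‖ := norm_pos_iff.2 ha0
  have ha1 : 0 < 1 - ‖a‖ := sub_pos.2 ha
  have hA : 0 < 4 * Real.pi * ((1 - ‖a‖) / ‖a‖) := by positivity
  have hw : ‖circleMap 0 r θ‖ < 1 := by simpa [abs_of_nonneg hr0] using hr
  have h1 := norm_sub_div_le_norm_discInvolution ha hw h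
  have h2 := norm_mul_abs_sin_le a hr0 θ
  have main (s : ℝ) (hs : |s| ≤ Real.pi) (hsin : |Real.sin (s / 2)| = |Real.sin ((θ - a.arg) / 2)|) :
      |s / (4 * Real.pi * ((1 - ‖a‖) / ‖a‖))| ≤ ‖discInvolution a (circleMap 0 r θ)‖ := by
    have h3 : 2 / Real.pi * |s / 2| ≤ |Real.sin (s / 2)| :=
      Real.mul_abs_le_abs_sin (by rw [abs_div, abs_two]; linarith)
    refine le_trans ?_ h1
    rw [abs_div, abs_of_pos hA, div_le_div_iff₀ hA (by positivity)]
    rw [hsin, abs_div, abs_two] at h3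
    have h4 : ‖a‖ * (2 / Real.pi * (|s| / 2)) ≤ ‖a - circleMap 0 r θ‖ := le_trans (by gcongr) h2
    calc |s| * (4 * (1 - ‖a‖)) =
          ‖a‖ * (2 / Real.pi * (|s| / 2)) * (4 * Real.pi * ((1 - ‖a‖) / ‖a‖)) := by field_simp
      _ ≤ _ := by gcongr
  rw [mul_add]
  have hle : ‖discInvolution a (circleMap 0 r θ)‖ ≤ 1 := h.trans (by norm_num)
  have harg1 := Complex.neg_pi_lt_arg a
  have harg2 := Complex.arg_le_pi a
  -- Here `θ - a.arg` lies between `-π` and `3π`, so at most one shift by `2π` brings it into `[-π,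
  -- π]`; hence two kernels.
  rcases le_or_gt (θ - a.arg) Real.pi with ht | ht
  · refine (ofReal_neg_log_rpow_le hp (main (θ - a.arg) ?_ rfl) hle).trans le_self_add
    rw [abs_le]
    constructor <;> linarith [hθ.1]
  · refine (ofReal_neg_log_rpow_le hp (main (θ - (a.arg + 2 * Real.pi)) ?_ ?_) hle).trans
      le_add_self
    · rw [abs_le]
      constructor <;> linarith [hθ.2]
    · rw [show (θ - (a.arg + 2 * Real.pi)) / 2 = (θ - a.arg) / 2 - Real.pi by ring,
        Real.sin_sub_pi, abs_neg]

/-! ### Convergence and measurability of the Blaschke product -/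

theorem norm_blaschkeFactor {a : ℂ} (ha : a ≠ 0) (w : ℂ) :
    ‖starRingEnd ℂ a * (a - w) / ((‖a‖ : ℂ) * (1 - starRingEnd ℂ a * w))‖ =
      ‖discInvolution a w‖ := by
  have := norm_pos_iff.2 ha
  rw [discInvolution, norm_div, norm_mul, norm_mul, RCLike.norm_conj, Complex.norm_real, norm_norm,
    mul_div_mul_left _ _ this.ne', norm_div]

theorem norm_blaschkeFactor_sub_one_le {a w : ℂ} (ha0 : a ≠ 0) (ha : ‖a‖ < 1) (hw : ‖w‖ < 1) :
    ‖starRingEnd ℂ a * (a - w) / ((‖a‖ : ℂ) * (1 - starRingEnd ℂ a * w)) - 1‖ ≤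
      2 / (1 - ‖w‖) * (1 - ‖a‖) := by
  have h0 := one_sub_conj_mul_ne_zero ha hw.le
  have han : 0 < ‖a‖ := norm_pos_iff.2 ha0
  have han' : (‖a‖ : ℂ) ≠ 0 := by exact_mod_cast han.ne'
  have hid : starRingEnd ℂ a * (a - w) / ((‖a‖ : ℂ) * (1 - starRingEnd ℂ a * w)) - 1 =
      ((1 - ‖a‖ : ℝ) : ℂ) * (-(‖a‖ + starRingEnd ℂ a * w)) /
        ((‖a‖ : ℂ) * (1 - starRingEnd ℂ a * w)) := by
    rw [div_sub_one (mul_ne_zero han' h0)]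
    congr 1
    push_cast
    linear_combination Complex.conj_mul' a
  have hden : 1 - ‖w‖ ≤ ‖1 - starRingEnd ℂ a * w‖ := by
    have := norm_sub_norm_le 1 (starRingEnd ℂ a * w)
    rw [norm_one, norm_mul, RCLike.norm_conj] at this
    nlinarith [norm_nonneg w]
  have hnum : ‖(‖a‖ : ℂ) + starRingEnd ℂ a * w‖ ≤ ‖a‖ * 2 := by
    refine (norm_add_le _ _).trans ?_
    rw [norm_mul, RCLike.norm_conj, Complex.norm_real, norm_norm]
    nlinarith
  have hw0 : 0 < 1 - ‖w‖ := sub_pos.2 hw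
  have ha1 : 0 ≤ 1 - ‖a‖ := (sub_pos.2 ha).le
  rw [hid, norm_div, norm_mul, norm_mul, norm_neg, Complex.norm_real, Complex.norm_real, norm_norm,
    Real.norm_of_nonneg ha1]
  calc (1 - ‖a‖) * ‖(‖a‖ : ℂ) + starRingEnd ℂ a * w‖ / (‖a‖ * ‖1 - starRingEnd ℂ a * w‖)
      ≤ (1 - ‖a‖) * (‖a‖ * 2) / (‖a‖ * (1 - ‖w‖)) := by gcongr
    _ = 2 / (1 - ‖w‖) * (1 - ‖a‖) := by field_simp

theorem IsBlaschkeSequence.multipliable {ι : Type*} {z : ι → ℂ} (hz : IsBlaschkeSequence z) {w : ℂ}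
    (hw : ‖w‖ < 1) :
    Multipliable fun i => starRingEnd ℂ (z i) * (z i - w) /
      ((‖z i‖ : ℂ) * (1 - starRingEnd ℂ (z i) * w)) := by
  have h := multipliable_one_add_of_summable (f := fun i => starRingEnd ℂ (z i) * (z i - w) /
    ((‖z i‖ : ℂ) * (1 - starRingEnd ℂ (z i) * w)) - 1)
    (Summable.of_nonneg_of_le (fun _ => norm_nonneg _)
      (fun i => norm_blaschkeFactor_sub_one_le (hz.ne_zero i) (hz.norm_lt_one i) hw)
      (hz.summable.mul_left _))
  simpa using h

theorem IsBlaschkeSequence.tendsto_prod_norm {ι : Type*} {z : ι → ℂ} (hz : IsBlaschkeSequence z)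
    {w : ℂ} (hw : ‖w‖ < 1) :
    Tendsto (fun S : Finset ι => ∏ i ∈ S, ‖discInvolution (z i) w‖) atTop
      (𝓝 ‖blaschkeProduct z w‖) := by
  have h := (hz.multipliable hw).hasProd.norm
  simp only [norm_blaschkeFactor (hz.ne_zero _)] at h
  exact h

theorem IsBlaschkeSequence.countable {ι : Type*} {z : ι → ℂ} (hz : IsBlaschkeSequence z) :
    Countable ι := by
  have h := hz.summable.countable_support
  rw [show Function.support (fun i => 1 - ‖z i‖) = univ from eq_univ_of_forall fun i =>
    (sub_pos.2 (hz.norm_lt_one i)).ne'] at h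
  exact countable_univ_iff.1 h

/-- All but finitely many points have modulus above `1/2`, so the division costs at most a factor 2
there. -/
theorem IsBlaschkeSequence.summable_div {ι : Type*} {z : ι → ℂ} (hz : IsBlaschkeSequence z) :
    Summable fun i => (1 - ‖z i‖) / ‖z i‖ := by
  refine Summable.of_norm_bounded_eventually (hz.summable.mul_left 2) ?_
  filter_upwards [hz.summable.tendsto_cofinite_zero.eventually_lt_const
    (show (0 : ℝ) < 1 / 2 by norm_num)] with i hi
  have h1 : 0 < 1 - ‖z i‖ := sub_pos.2 (hz.norm_lt_one i)
  have h2 : 0 < ‖z i‖ := norm_pos_iff.2 (hz.ne_zero i)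
  rw [Real.norm_of_nonneg (by positivity), div_le_iff₀ h2]
  nlinarith

theorem IsBlaschkeSequence.aemeasurable_norm {ι : Type*} {z : ι → ℂ} (hz : IsBlaschkeSequence z)
    {r : ℝ} (hr0 : 0 ≤ r) (hr : r < 1) (μ : Measure ℝ) :
    AEMeasurable (fun θ => ‖blaschkeProduct z (circleMap 0 r θ)‖) μ := by
  have := hz.countable
  refine aemeasurable_of_tendsto_metrizable_ae (atTop : Filter (Finset ι))
    (f := fun S θ => ∏ i ∈ S, ‖discInvolution (z i) (circleMap 0 r θ)‖) (fun S => ?_)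
    (Eventually.of_forall fun θ => hz.tendsto_prod_norm ?_)
  · have hc : Measurable (circleMap 0 r) := (continuous_circleMap 0 r).measurable
    refine Measurable.aemeasurable (Finset.measurable_prod _ fun i _ => ?_)
    unfold discInvolution
    fun_prop
  · simpa [abs_of_nonneg hr0] using hr

/-! ### Domination and integration -/

/-- A function of the angle, independent of the radius, dominating `|log ‖B‖| ^ p` on every
circle. -/
theorem IsBlaschkeSequence.ofReal_abs_log_rpow_le {ι : Type*} {z : ι → ℂ}
    (hz : IsBlaschkeSequence z) {K p r θ : ℝ} (hp : 1 ≤ p)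
    (hK : ∀ (S : Finset ι) (w : ℂ), ‖w‖ < 1 →
      ∑ i ∈ S, (1 - ‖discInvolution (z i) w‖ ^ 2) ≤ K)
    (hr0 : 0 ≤ r) (hr : r < 1) (hθ : θ ∈ Ioc 0 (2 * Real.pi)) :
    ENNReal.ofReal (|Real.log ‖blaschkeProduct z (circleMap 0 r θ)‖| ^ p) ≤
      ENNReal.ofReal ((2 * K + 1) ^ (p - 1)) * (ENNReal.ofReal ((2 * K) ^ p) +
        ∑' i, ENNReal.ofReal ((2 * p) ^ p) *
          (invSqrtKernel ((θ - (z i).arg) / (4 * Real.pi * ((1 - ‖z i‖) / ‖z i‖))) +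
            invSqrtKernel ((θ - ((z i).arg + 2 * Real.pi)) /
              (4 * Real.pi * ((1 - ‖z i‖) / ‖z i‖))))) := by
  set w := circleMap 0 r θ with hw
  have hw1 : ‖w‖ < 1 := by simpa [hw, abs_of_nonneg hr0] using hr
  have hK0 : 0 ≤ K := by simpa using hK ∅ w hw1
  -- At a zero of the product `Real.log 0 = 0` makes the left side vanish; elsewhere the logarithm
  -- is continuous and finite products suffice.
  rcases eq_or_ne ‖blaschkeProduct z w‖ 0 with hB | hB
  · rw [hB, Real.log_zero, abs_zero, Real.zero_rpow (by linarith), ENNReal.ofReal_zero]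
    exact zero_le
  have hlim : Tendsto (fun S : Finset ι =>
      ENNReal.ofReal (|Real.log (∏ i ∈ S, ‖discInvolution (z i) w‖)| ^ p)) atTop
      (𝓝 (ENNReal.ofReal (|Real.log ‖blaschkeProduct z w‖| ^ p))) :=
    ENNReal.tendsto_ofReal ((((hz.tendsto_prod_norm hw1).log hB).abs).rpow_const
      (Or.inr (by linarith)))
  refine le_of_tendsto hlim (Eventually.of_forall fun S => ?_)
  have hρ1 (i : ι) : ‖discInvolution (z i) w‖ ≤ 1 :=
    (norm_discInvolution_lt_one (hz.norm_lt_one i) hw1).le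
  have hlog (i : ι) : 0 ≤ (-Real.log ‖discInvolution (z i) w‖) ^ p :=
    Real.rpow_nonneg (neg_nonneg.2 (Real.log_nonpos (norm_nonneg _) (hρ1 i))) _
  refine (ENNReal.ofReal_le_ofReal (abs_log_prod_rpow_le S hp (fun i _ => norm_nonneg _)
    (fun i _ => hρ1 i) (hK S w hw1))).trans ?_
  rw [ENNReal.ofReal_mul (by positivity), ENNReal.ofReal_add (by positivity)
    (Finset.sum_nonneg fun i _ => hlog i), ENNReal.ofReal_sum_of_nonneg fun i _ => hlog i]
  gcongr
  refine le_trans (Finset.sum_le_sum fun i hi => ?_) (ENNReal.sum_le_tsum _)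
  exact ofReal_neg_log_norm_discInvolution_rpow_le (by linarith) (hz.ne_zero i) (hz.norm_lt_one i)
    hr0 hr hθ (Finset.mem_filter.1 hi).2

/-- The integrals of `|log ‖B‖| ^ p` over the circles `‖w‖ = r` are bounded. -/
theorem IsBlaschkeSequence.exists_lintegral_abs_log_rpow_le {ι : Type*} {z : ι → ℂ}
    (hz : IsBlaschkeSequence z) (hint : IsInterpolating z) {p : ℝ} (hp : 1 ≤ p) :
    ∃ D : ℝ≥0∞, D < ∞ ∧ ∀ r : ℝ, 0 ≤ r → r < 1 →
      ∫⁻ θ in Ioc 0 (2 * Real.pi),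
        ENNReal.ofReal (|Real.log ‖blaschkeProduct z (circleMap 0 r θ)‖| ^ p) ≤ D := by
  have := hz.countable
  obtain ⟨K, hK⟩ := hint.exists_sum_one_sub_sq_le hz.norm_lt_one
  have hA (i : ι) : 0 < 4 * Real.pi * ((1 - ‖z i‖) / ‖z i‖) := by
    have h1 : 0 < 1 - ‖z i‖ := sub_pos.2 (hz.norm_lt_one i)
    have h2 : 0 < ‖z i‖ := norm_pos_iff.2 (hz.ne_zero i)
    positivity
  refine ⟨_, ?_, fun r hr0 hr => setLIntegral_mono' measurableSet_Ioc fun θ hθ =>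
    hz.ofReal_abs_log_rpow_le hp hK hr0 hr hθ⟩
  rw [lintegral_const_mul _ (by fun_prop), lintegral_add_left (by fun_prop),
    lintegral_tsum (fun i => by fun_prop), setLIntegral_const]
  have hterm (i : ι) : ∫⁻ θ in Ioc 0 (2 * Real.pi), ENNReal.ofReal ((2 * p) ^ p) *
      (invSqrtKernel ((θ - (z i).arg) / (4 * Real.pi * ((1 - ‖z i‖) / ‖z i‖))) +
        invSqrtKernel ((θ - ((z i).arg + 2 * Real.pi)) /
          (4 * Real.pi * ((1 - ‖z i‖) / ‖z i‖)))) ≤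
      ENNReal.ofReal ((2 * p) ^ p) * (2 * ∫⁻ s, invSqrtKernel s) *
        ENNReal.ofReal (4 * Real.pi * ((1 - ‖z i‖) / ‖z i‖)) := by
    refine (setLIntegral_le_lintegral _ _).trans_eq ?_
    rw [lintegral_const_mul _ (by fun_prop), lintegral_add_left (by fun_prop),
      lintegral_invSqrtKernel_sub_div (hA i), lintegral_invSqrtKernel_sub_div (hA i)]
    ring
  refine ENNReal.mul_lt_top ENNReal.ofReal_lt_top (ENNReal.add_lt_top.2 ⟨?_, ?_⟩)
  · exact ENNReal.mul_lt_top ENNReal.ofReal_lt_top measure_Ioc_lt_top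
  · refine (ENNReal.tsum_le_tsum hterm).trans_lt ?_
    rw [ENNReal.tsum_mul_left, ← ENNReal.ofReal_tsum_of_nonneg (fun i => (hA i).le)
      (hz.summable_div.mul_left _)]
    exact ENNReal.mul_lt_top (ENNReal.mul_lt_top ENNReal.ofReal_lt_top
      (ENNReal.mul_lt_top (by simp) lintegral_invSqrtKernel_lt_top)) ENNReal.ofReal_lt_top

theorem corollary2 {ι : Type*} (z : ι → ℂ) (hz : IsBlaschkeSequence z)
    (hint : IsInterpolating z) (p : ℝ) (hp : 1 ≤ p) :
    ∃ C : ℝ, ∀ r : ℝ, 0 < r → r < 1 →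
      CircleIntegrable (fun w => |Real.log ‖blaschkeProduct z w‖| ^ p) 0 r ∧
        logMean p r (blaschkeProduct z) ≤ C * (Real.log (1 / (1 - r)) ^ 2 + 1) := by
  obtain ⟨D, hD, h⟩ := hz.exists_lintegral_abs_log_rpow_le hint hp
  have hpi := Real.two_pi_pos
  refine ⟨((2 * Real.pi)⁻¹ * D.toReal) ^ (1 / p), fun r hr0 hr => ?_⟩
  have hnn (θ : ℝ) : 0 ≤ |Real.log ‖blaschkeProduct z (circleMap 0 r θ)‖| ^ p := by positivity
  have hm : AEStronglyMeasurable
      (fun θ => |Real.log ‖blaschkeProduct z (circleMap 0 r θ)‖| ^ p)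
      (volume.restrict (Ioc 0 (2 * Real.pi))) := by
    have h1 := hz.aemeasurable_norm hr0.le hr (volume.restrict (Ioc 0 (2 * Real.pi)))
    have h2 := (Real.measurable_log.comp_aemeasurable h1)
    have h3 : Measurable fun x : ℝ => |x| ^ p := by fun_prop
    exact (h3.comp_aemeasurable h2).aestronglyMeasurable
  constructor
  · rw [CircleIntegrable, intervalIntegrable_iff_integrableOn_Ioc_of_le hpi.le]
    refine ⟨hm, ?_⟩
    rw [hasFiniteIntegral_iff_ofReal (Eventually.of_forall hnn)]
    exact (h r hr0.le hr).trans_lt hD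
  · have hI : Real.circleAverage (fun w => |Real.log ‖blaschkeProduct z w‖| ^ p) 0 r ≤
        (2 * Real.pi)⁻¹ * D.toReal := by
      rw [Real.circleAverage_def, smul_eq_mul, intervalIntegral.integral_of_le hpi.le,
        integral_eq_lintegral_of_nonneg_ae (Eventually.of_forall hnn) hm]
      gcongr
      · exact hD.ne
      · exact h r hr0.le hr
    have hI0 : 0 ≤ Real.circleAverage (fun w => |Real.log ‖blaschkeProduct z w‖| ^ p) 0 r :=
      Real.circleAverage_nonneg_of_nonneg fun w _ => by positivity
    refine (Real.rpow_le_rpow hI0 hI (by positivity)).trans ?_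
    -- The uniform bound is already `C`; the remaining factor is at least 1.
    refine le_mul_of_one_le_right (by positivity) ?_
    linarith [sq_nonneg (Real.log (1 / (1 - r)))]
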